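/- For $n\ge 1$ let $M_n^{(1)}=\sum_{k=1}^n X_k^{(1)}$ be the magnetisation of the Curie–Weiss model of $n$ spins at inverse temperature $\beta=1$ without external field: the law of $(X_1^{(1)},\dots,X_n^{(1)})$ has density $e^{S_n^2/(2n)}/\mathbb{E}\big[e^{S_n^2/(2n)}\big]$ with respect to the law of $(X_1,\dots,X_n)$, where $X_1,\dots,X_n$ are i.i.d. uniform on $\{-1,1\}$ and $S_n=X_1+\dots+X_n$. Let $\mathbf F$ be a real random variable with law $\frac{1}{\mathcal Z_{\mathbf F}}e^{-x^4/12}\,dx$, where $\mathcal Z_{\mathbf F}=\int_{\mathbb R}e^{-x^4/12}\,dx$. Then $\mathcal Z_{\mathbf F}=3^{1/4}\,2^{-1/2}\,\Gamma(1/4)$. Moreover, there are an absolute constant $C>0$ and a real sequence $(r_n)_{n\ge1}$ with $r_n=O(n^{-3/4})$ as $n\to\infty$ such that, for all $n\ge1$ and all $h\in\mathcal C^1(\mathbb R,\mathbb R)$ with $\|h\|_\infty<\infty$ and $\|h'\|_\infty<\infty$, $$\left|\,\mathbb{E}\,h\!\left(\frac{M_n^{(1)}}{n^{3/4}}\right)-\mathbb{E}\,h(\mathbf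 F)\right|\le\left(\frac{C}{\sqrt n}+r_n\right)\big(\|h\|_\infty+\|h'\|_\infty\big).$$ Here $C$ and $(r_n)$ do not depend on $h$, and $C$ does not depend on $n$. -/

import Mathlib

open MeasureTheory Filter Asymptotics
open scoped ENNReal

noncomputable section

namespace CurieWeiss

/-- The symmetric Bernoulli law on `{-1, 1}`, seen as a measure on `ℝ`. -/
def symmBernoulli : Measure ℝ :=
  (2⁻¹ : ℝ≥0∞) • Measure.dirac 1 + (2⁻¹ : ℝ≥0∞) • Measure.dirac (-1)

instance instIsProbabilityMeasureSymmBernoulli : IsProbabilityMeasure symmBernoulli where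
  measure_univ := by simp [symmBernoulli, ENNReal.inv_two_add_inv_two]

/-- The Curie-Weiss law of `n` spins at inverse temperature `β`, without external field:
the law of `n` i.i.d. symmetric `±1` spins `X_1, …, X_n`, reweighted by the density
`exp (β S_n² / (2 n)) / E[exp (β S_n² / (2 n))]`, where `S_n = X_1 + ⋯ + X_n`. -/
def spinLaw (n : ℕ) (β : ℝ) : Measure (Fin n → ℝ) :=
  (Measure.pi fun _ : Fin n => symmBernoulli).tilted
    fun x => β / (2 * (n : ℝ)) * (∑ k, x k) ^ 2

/-- The law of the unnormalised magnetisation `M_n^{(β)}`, the sum of the `n` Curie-Weiss spins. -/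
def magnetisationLaw (n : ℕ) (β : ℝ) : Measure ℝ :=
  (spinLaw n β).map fun x => ∑ k, x k

/-- The normalising constant `∫ exp (-x⁴/12) dx`. -/
def quarticConst : ℝ := ∫ x : ℝ, Real.exp (-x ^ 4 / 12)

/-- The law on `ℝ` with density `exp (-x⁴/12) / ∫ exp (-y⁴/12) dy`. -/
def quarticLaw : Measure ℝ :=
  volume.withDensity fun x => ENNReal.ofReal (Real.exp (-x ^ 4 / 12) / quarticConst)

/-- The uniform norm of a (bounded) real function. -/
def supNorm (f : ℝ → ℝ) : ℝ := ⨆ x : ℝ, |f x|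

end CurieWeiss

end

namespace CurieWeiss

/-! The law of a sum of independent symmetric spins. -/

lemma lintegral_symmBernoulli (g : ℝ → ℝ≥0∞) :
    ∫⁻ x, g x ∂symmBernoulli = 2⁻¹ * g 1 + 2⁻¹ * g (-1) := by
  simp [symmBernoulli]

lemma lintegral_sum_pi_symmBernoulli (n : ℕ) (g : ℝ → ℝ≥0∞) (hg : Measurable g) :
    ∫⁻ x, g (∑ k, x k) ∂(Measure.pi fun _ : Fin n => symmBernoulli)
      = ∑ j ∈ Finset.range (n + 1), (n.choose j : ℝ≥0∞) * (2⁻¹ ^ n * g (2 * j - n)) := by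
  induction n generalizing g with
  | zero => simp
  | succ n ih =>
    have hmp := (measurePreserving_piFinSuccAbove (fun _ : Fin (n + 1) => symmBernoulli) 0).symm
    rw [← hmp.lintegral_comp_emb (MeasurableEquiv.measurableEmbedding _)]
    have hcomp : ∀ z : ℝ × (Fin n → ℝ),
        g (∑ k, ((MeasurableEquiv.piFinSuccAbove (fun _ : Fin (n + 1) => ℝ) 0).symm z) k)
          = g (z.1 + ∑ k, z.2 k) := by
      intro z
      rw [Fin.sum_univ_succ]
      simp [MeasurableEquiv.piFinSuccAbove]
    simp only [hcomp]
    rw [lintegral_prod _ (by fun_prop), lintegral_symmBernoulli,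
      ih (fun y => g (1 + y)) (by fun_prop), ih (fun y => g (-1 + y)) (by fun_prop),
      Finset.sum_choose_succ_mul (fun i _ => 2⁻¹ ^ (n + 1) * g (2 * i - (n + 1 : ℕ))) n,
      Finset.mul_sum, Finset.mul_sum, add_comm]
    congr 1 <;> refine Finset.sum_congr rfl fun j _ => ?_
    · rw [show (-1 + (2 * j - n) : ℝ) = 2 * j - (n + 1 : ℕ) by push_cast; ring]
      ring
    · rw [show (1 + (2 * j - n) : ℝ) = 2 * (j + 1 : ℕ) - (n + 1 : ℕ) by push_cast; ring]
      ring

lemma map_sum_pi_symmBernoulli (n : ℕ) :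
    (Measure.pi fun _ : Fin n => symmBernoulli).map (fun x => ∑ k, x k)
      = ∑ j ∈ Finset.range (n + 1),
          ((n.choose j : ℝ≥0∞) * 2⁻¹ ^ n) • Measure.dirac (2 * j - n : ℝ) := by
  ext s hs
  rw [← lintegral_indicator_one hs,
    lintegral_map (measurable_one.indicator hs) (by fun_prop),
    lintegral_sum_pi_symmBernoulli n _ (measurable_one.indicator hs)]
  simp [Measure.finsetSum_apply, hs, mul_assoc]

lemma integral_sum_pi_symmBernoulli (n : ℕ) (g : ℝ → ℝ) (hg : Measurable g) :
    ∫ x, g (∑ k, x k) ∂(Measure.pi fun _ : Fin n => symmBernoulli)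
      = 2⁻¹ ^ n * ∑ j ∈ Finset.range (n + 1), n.choose j * g (2 * j - n) := by
  rw [← integral_map (φ := fun x : Fin n → ℝ => ∑ k, x k) (by fun_prop)
    hg.aestronglyMeasurable, map_sum_pi_symmBernoulli, integral_finsetSum_measure]
  · simp [integral_smul_measure, Finset.mul_sum, ENNReal.toReal_mul]
    refine Finset.sum_congr rfl fun j _ => ?_
    ring
  · intro j _
    refine Integrable.smul_measure (integrable_dirac (by simp)) ?_
    exact ENNReal.mul_ne_top (by simp) (by simp)

lemma integral_magnetisationLaw_one (n : ℕ) (g : ℝ → ℝ) (hg : Measurable g) :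
    ∫ m, g m ∂(magnetisationLaw n 1)
      = (∑ j ∈ Finset.range (n + 1),
            n.choose j * Real.exp ((2 * j - n : ℝ) ^ 2 / (2 * n)) * g (2 * j - n))
        / ∑ j ∈ Finset.range (n + 1), n.choose j * Real.exp ((2 * j - n : ℝ) ^ 2 / (2 * n)) := by
  rw [magnetisationLaw, integral_map (by fun_prop) hg.aestronglyMeasurable, spinLaw,
    integral_tilted]
  rw [integral_sum_pi_symmBernoulli n (fun y => Real.exp (1 / (2 * n) * y ^ 2)) (by fun_prop)]
  set c := 2⁻¹ ^ n * ∑ j ∈ Finset.range (n + 1),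
    (n.choose j : ℝ) * Real.exp (1 / (2 * n) * (2 * j - n) ^ 2) with hc
  rw [integral_sum_pi_symmBernoulli n
    (fun y => (Real.exp (1 / (2 * n) * y ^ 2) / c) • g y) (by fun_prop)]
  have hexp : ∀ j : ℕ, Real.exp (1 / (2 * n) * (2 * j - n) ^ 2)
      = Real.exp ((2 * j - n : ℝ) ^ 2 / (2 * n)) := fun j => by congr 1; ring
  simp only [hexp, smul_eq_mul] at hc ⊢
  have h2 : (2⁻¹ : ℝ) ^ n ≠ 0 := by positivity
  rw [← mul_div_mul_left _ _ h2, ← hc, mul_div_assoc, Finset.sum_div]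
  congr 1
  refine Finset.sum_congr rfl fun j _ => ?_
  ring

end CurieWeiss

/-! Bounds for `log (1 + t) - log (1 - t)`. -/

lemma Real.le_log_one_add_sub_log_one_sub {t : ℝ} (h0 : 0 ≤ t) (h1 : t < 1) :
    2 * t + 2 / 3 * t ^ 3 ≤ Real.log (1 + t) - Real.log (1 - t) := by
  have h := Real.hasSum_log_sub_log_of_abs_lt_one (abs_lt.2 ⟨by linarith, h1⟩)
  have := sum_le_hasSum (Finset.range 2) (fun i _ => by positivity) h
  norm_num [Finset.sum_range_succ] at this
  linarith

lemma Real.log_one_add_sub_log_one_sub_le {t : ℝ} (h0 : 0 ≤ t) (h1 : t ≤ 1 / 2) :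
    Real.log (1 + t) - Real.log (1 - t) ≤ 2 * t + 2 / 3 * t ^ 3 + t ^ 5 := by
  have key : MonotoneOn (fun t : ℝ => 2 * t + 2 / 3 * t ^ 3 + t ^ 5
      - (Real.log (1 + t) - Real.log (1 - t))) (Set.Icc 0 (1 / 2)) := by
    have hd : ∀ x ∈ Set.Icc (0 : ℝ) (1 / 2), HasDerivAt (fun t : ℝ => 2 * t + 2 / 3 * t ^ 3 + t ^ 5
        - (Real.log (1 + t) - Real.log (1 - t)))
        (2 + 2 * x ^ 2 + 5 * x ^ 4 - (1 / (1 + x) + 1 / (1 - x))) x := by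
      intro x hx
      have ha : (1 : ℝ) + x ≠ 0 := by linarith [hx.1]
      have hb : (1 : ℝ) - x ≠ 0 := by linarith [hx.2]
      have e1 := ((hasDerivAt_id x).const_add 1).log ha
      have e2 := ((hasDerivAt_id x).const_sub 1).log hb
      have e3 := (((hasDerivAt_id x).const_mul 2).add
        (((hasDerivAt_id x).pow 3).const_mul (2 / 3))).add ((hasDerivAt_id x).pow 5)
      refine (e3.sub (e1.sub e2)).congr_deriv ?_
      simp
      ring
    refine monotoneOn_of_deriv_nonneg (convex_Icc _ _)
      (fun x hx => (hd x hx).continuousAt.continuousWithinAt)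
      (fun x hx => (hd x (interior_subset hx)).differentiableAt.differentiableWithinAt) ?_
    intro x hx
    have hx := interior_subset hx
    rw [(hd x hx).deriv]
    have ha : (0 : ℝ) < 1 + x := by linarith [hx.1]
    have hb : (0 : ℝ) < 1 - x := by linarith [hx.2]
    have hx2 : x ^ 2 ≤ 1 / 4 := by nlinarith [hx.1, hx.2]
    have : 2 + 2 * x ^ 2 + 5 * x ^ 4 - (1 / (1 + x) + 1 / (1 - x))
        = x ^ 4 * (3 - 5 * x ^ 2) / ((1 + x) * (1 - x)) := by
      field_simp
      ring
    rw [this]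
    have : 0 ≤ 3 - 5 * x ^ 2 := by linarith
    positivity
  have := key ⟨le_rfl, by norm_num⟩ ⟨h0, h1⟩ h0
  simp at this
  linarith

namespace CurieWeiss

/-- The logarithm of the ratio of the Curie-Weiss weight of the magnetisation `2 j - n` to the
quartic weight. -/
noncomputable def logRatio (n j : ℕ) : ℝ :=
  Real.log (n.choose j) + (2 * j - n : ℝ) ^ 2 / (2 * n) + (2 * j - n : ℝ) ^ 4 / (12 * n ^ 3)

lemma logRatio_symm {n j : ℕ} (hj : j ≤ n) : logRatio n (n - j) = logRatio n j := by
  rw [logRatio, logRatio, Nat.choose_symm hj, Nat.cast_sub hj]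
  ring

lemma logRatio_succ {n j : ℕ} (hj : j < n) {m : ℝ} (hm : m = 2 * j + 1 - n) :
    logRatio n (j + 1) = logRatio n j
      - (Real.log (1 + m / (n + 1)) - Real.log (1 - m / (n + 1)))
      + 2 * m / n + 2 / 3 * (m ^ 3 + m) / n ^ 3 := by
  have hn : (0 : ℝ) < n := by exact_mod_cast (by omega : 0 < n)
  have hjn : (j : ℝ) + 1 ≤ n := by exact_mod_cast hj
  have hj0 : (0 : ℝ) ≤ j := by positivity
  have hc : (n.choose (j + 1) : ℝ) * (j + 1) = n.choose j * (n - j) := by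
    have := Nat.choose_succ_right_eq n j
    rw [← Nat.cast_sub hj.le]
    exact_mod_cast this
  have p1 : (0 : ℝ) < n.choose (j + 1) := by exact_mod_cast Nat.choose_pos hj
  have p0 : (0 : ℝ) < n.choose j := by exact_mod_cast Nat.choose_pos hj.le
  have hl := congrArg Real.log hc
  rw [Real.log_mul p1.ne' (by positivity), Real.log_mul p0.ne' (by linarith)] at hl
  have e1 : 1 + m / (n + 1 : ℝ) = (j + 1) * (2 / (n + 1)) := by
    rw [hm]; field_simp; ring
  have e2 : 1 - m / (n + 1 : ℝ) = (n - j) * (2 / (n + 1)) := by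
    rw [hm]; field_simp; ring
  rw [e1, e2, Real.log_mul (by positivity) (by positivity),
    Real.log_mul (by linarith) (by positivity), logRatio, logRatio]
  have hp : (2 * ((j + 1 : ℕ) : ℝ) - n) = m + 1 := by rw [hm]; push_cast; ring
  have hp' : (2 * (j : ℝ) - n) = m - 1 := by rw [hm]; ring
  rw [hp, hp']
  have e3 : (m + 1) ^ 2 / (2 * n : ℝ) = (m - 1) ^ 2 / (2 * n) + 2 * m / n := by
    field_simp; ring
  have e4 : (m + 1) ^ 4 / (12 * n ^ 3 : ℝ)
      = (m - 1) ^ 4 / (12 * n ^ 3) + 2 / 3 * (m ^ 3 + m) / n ^ 3 := by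
    field_simp; ring
  linarith

lemma logRatio_succ_le {n j : ℕ} (hj : j < n) (hs : n ≤ 2 * j + 1) :
    logRatio n (j + 1) ≤ logRatio n j + 5 * (2 * j + 1 - n) / n ^ 2 := by
  obtain ⟨m, hm⟩ : ∃ m : ℝ, m = 2 * j + 1 - n := ⟨_, rfl⟩
  have hn : (1 : ℝ) ≤ n := by exact_mod_cast (by omega : 1 ≤ n)
  have hm0 : 0 ≤ m := by
    have : (n : ℝ) ≤ 2 * j + 1 := by exact_mod_cast hs
    linarith
  have hmn : m ≤ n := by
    have : (j : ℝ) + 1 ≤ n := by exact_mod_cast hj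
    linarith
  have hN : (0 : ℝ) < n + 1 := by positivity
  have hlog := Real.le_log_one_add_sub_log_one_sub (t := m / (n + 1)) (by positivity)
    (by rw [div_lt_one hN]; linarith)
  rw [logRatio_succ hj hm, ← hm]
  suffices 2 * m / n + 2 / 3 * (m ^ 3 + m) / n ^ 3
      ≤ 2 * (m / (n + 1)) + 2 / 3 * (m / (n + 1)) ^ 3 + 5 * m / n ^ 2 by linarith
  have h1 : 2 * m / n ≤ 2 * (m / (n + 1)) + 2 * (m / n ^ 2) := by
    have : 1 / (n : ℝ) ≤ 1 / (n + 1) + 1 / n ^ 2 := by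
      rw [div_add_div _ _ (by positivity) (by positivity), div_le_div_iff₀ (by positivity)
        (by positivity)]
      nlinarith
    calc 2 * m / n = 2 * m * (1 / n) := by ring
      _ ≤ 2 * m * (1 / (n + 1) + 1 / n ^ 2) := by gcongr
      _ = _ := by ring
  have h2 : m ^ 3 / n ^ 3 ≤ (m / (n + 1)) ^ 3 + 3 * (m / n ^ 2) := by
    have : 1 / (n : ℝ) ^ 3 ≤ 1 / (n + 1) ^ 3 + 3 / n ^ 4 := by
      rw [div_add_div _ _ (by positivity) (by positivity), div_le_div_iff₀ (by positivity)
        (by positivity)]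
      have : 0 ≤ (n : ℝ) ^ 3 * (6 * n ^ 2 + 8 * n + 3) := by positivity
      nlinarith
    calc m ^ 3 / n ^ 3 = m ^ 3 * (1 / n ^ 3) := by ring
      _ ≤ m ^ 3 * (1 / (n + 1) ^ 3 + 3 / n ^ 4) := by gcongr
      _ = (m / (n + 1)) ^ 3 + 3 * (m * m ^ 2 / n ^ 4) := by rw [div_pow]; ring
      _ ≤ (m / (n + 1)) ^ 3 + 3 * (m * n ^ 2 / n ^ 4) := by gcongr
      _ = _ := by field_simp
  have h3 : m / n ^ 3 ≤ m / (n : ℝ) ^ 2 := by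
    gcongr 2
    norm_num
  have e1 : 2 / 3 * (m ^ 3 + m) / (n : ℝ) ^ 3 = 2 / 3 * (m ^ 3 / n ^ 3) + 2 / 3 * (m / n ^ 3) := by
    ring
  have e2 : 5 * m / (n : ℝ) ^ 2 = 5 * (m / n ^ 2) := by ring
  have : 0 ≤ m / (n : ℝ) ^ 2 := by positivity
  rw [e1, e2]
  linarith

lemma le_logRatio_succ {n j : ℕ} (hj : j < n) (hs : n ≤ 2 * j + 1) (hj2 : 4 * j + 2 ≤ 3 * n) :
    logRatio n j - (2 * j + 1 - n) ^ 5 / n ^ 5 ≤ logRatio n (j + 1) := by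
  obtain ⟨m, hm⟩ : ∃ m : ℝ, m = 2 * j + 1 - n := ⟨_, rfl⟩
  have hn : (0 : ℝ) < n := by exact_mod_cast (by omega : 0 < n)
  have hm0 : 0 ≤ m := by
    have : (n : ℝ) ≤ 2 * j + 1 := by exact_mod_cast hs
    linarith
  have hmn : 2 * m ≤ n := by
    have : 4 * (j : ℝ) + 2 ≤ 3 * n := by exact_mod_cast hj2
    linarith
  have hN : (0 : ℝ) < n + 1 := by positivity
  have hlog := Real.log_one_add_sub_log_one_sub_le (t := m / (n + 1)) (by positivity)
    (by rw [div_le_div_iff₀ hN (by norm_num)]; linarith)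
  rw [logRatio_succ hj hm, ← hm]
  have hle : m / (n + 1) ≤ m / n := by gcongr; linarith
  have h1 : 2 * (m / (n + 1)) ≤ 2 * m / n := by rw [mul_div_assoc]; gcongr
  have h3 : 2 / 3 * (m / (n + 1)) ^ 3 ≤ 2 / 3 * (m ^ 3 + m) / n ^ 3 := by
    calc 2 / 3 * (m / (n + 1)) ^ 3 ≤ 2 / 3 * (m / n) ^ 3 := by gcongr
      _ = 2 / 3 * m ^ 3 / n ^ 3 := by ring
      _ ≤ _ := by gcongr; linarith
  have h5 : (m / (n + 1)) ^ 5 ≤ m ^ 5 / n ^ 5 := by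
    rw [← div_pow]; gcongr
  linarith

lemma logRatio_le_of_half_le {n j : ℕ} (hj : (n + 1) / 2 ≤ j) (hjn : j ≤ n) :
    logRatio n j ≤ logRatio n ((n + 1) / 2) + 5 / 4 * (2 * j - n) ^ 2 / n ^ 2 := by
  induction j, hj using Nat.le_induction with
  | base => linarith [show 0 ≤ 5 / 4 * (2 * (((n + 1) / 2 : ℕ) : ℝ) - n) ^ 2 / n ^ 2 by positivity]
  | succ j hj ih =>
    have h1 := logRatio_succ_le (n := n) (j := j) (by omega) (by omega)
    have h2 := ih (by omega)
    have : 5 / 4 * (2 * ((j + 1 : ℕ) : ℝ) - n) ^ 2 / n ^ 2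
      = 5 / 4 * (2 * j - n) ^ 2 / n ^ 2 + 5 * (2 * j + 1 - n) / n ^ 2 := by push_cast; ring
    linarith

lemma le_logRatio_of_half_le {n j : ℕ} (hj : (n + 1) / 2 ≤ j) (hj3 : 4 * j ≤ 3 * n) :
    logRatio n ((n + 1) / 2) - (2 * j - n) ^ 6 / n ^ 5 ≤ logRatio n j := by
  induction j, hj using Nat.le_induction with
  | base => linarith [show 0 ≤ (2 * (((n + 1) / 2 : ℕ) : ℝ) - n) ^ 6 / n ^ 5 by positivity]
  | succ j hj ih =>
    have h1 := le_logRatio_succ (n := n) (j := j) (by omega) (by omega) (by omega)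
    have h2 := ih (by omega)
    have hm : (0 : ℝ) ≤ 2 * j + 1 - n := by
      have : (n : ℝ) ≤ 2 * j + 1 := by exact_mod_cast (by omega : n ≤ 2 * j + 1)
      linarith
    have : (2 * (j : ℝ) - n) ^ 6 / n ^ 5 + (2 * j + 1 - n) ^ 5 / n ^ 5
        ≤ (2 * ((j + 1 : ℕ) : ℝ) - n) ^ 6 / n ^ 5 := by
      rw [← add_div]
      gcongr
      push_cast
      generalize hx : 2 * (j : ℝ) + 1 - n = m at hm
      rw [show 2 * (j : ℝ) - n = m - 1 by rw [← hx]; ring,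
        show 2 * ((j : ℝ) + 1) - n = m + 1 by rw [← hx]; ring]
      have : 0 ≤ 11 * m ^ 5 + 40 * m ^ 3 + 12 * m := by positivity
      linarith [show (m + 1) ^ 6 - ((m - 1) ^ 6 + m ^ 5) = 11 * m ^ 5 + 40 * m ^ 3 + 12 * m by ring]
    linarith

lemma abs_exp_logRatio_sub_one_le {n j : ℕ} (hn : 1 ≤ n) (hjn : j ≤ n) :
    |Real.exp (logRatio n j - logRatio n ((n + 1) / 2)) - 1|
      ≤ 20 * ((2 * j - n) ^ 2 / n ^ 2 + (2 * j - n) ^ 6 / n ^ 5) := by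
  wlog hj : (n + 1) / 2 ≤ j generalizing j
  · have := this (j := n - j) (by omega) (by omega)
    rw [logRatio_symm hjn, Nat.cast_sub hjn] at this
    convert this using 2
    ring
  have hn' : (0 : ℝ) < n := by exact_mod_cast hn
  have hk0 : (0 : ℝ) ≤ 2 * j - n := by
    have : (n : ℝ) ≤ 2 * j := by exact_mod_cast (by omega : n ≤ 2 * j)
    linarith
  have hkn : (2 * j - n : ℝ) ≤ n := by
    have : (j : ℝ) ≤ n := by exact_mod_cast hjn
    linarith
  have hup := logRatio_le_of_half_le hj hjn
  have hlow := fun h3 => le_logRatio_of_half_le (n := n) hj h3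
  have hj3 : ¬ 4 * j ≤ 3 * n → (n : ℝ) ≤ 2 * (2 * j - n) := by
    intro h
    have : (3 * n : ℝ) ≤ 4 * j := by exact_mod_cast (by omega : 3 * n ≤ 4 * j)
    linarith
  generalize hd : logRatio n j - logRatio n ((n + 1) / 2) = d at *
  generalize (2 * j - n : ℝ) = k at *
  have a2 : 0 ≤ k ^ 2 / (n : ℝ) ^ 2 := by positivity
  have a6 : 0 ≤ k ^ 6 / (n : ℝ) ^ 5 := by positivity
  have a1 : k ^ 2 / (n : ℝ) ^ 2 ≤ 1 := by
    rw [← div_pow]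
    exact pow_le_one₀ (by positivity) ((div_le_one hn').2 hkn)
  have hd1 : d ≤ 5 / 4 * (k ^ 2 / n ^ 2) := by rw [← mul_div_assoc]; linarith
  rw [abs_le]
  constructor
  · by_cases h3 : 4 * j ≤ 3 * n
    · have := hlow h3
      have := Real.add_one_le_exp d
      linarith
    · have h4 : 1 ≤ 4 * (k ^ 2 / (n : ℝ) ^ 2) := by
        rw [← mul_div_assoc, le_div_iff₀ (by positivity)]
        nlinarith [hj3 h3]
      have := Real.exp_pos d
      linarith
  · have h1 : Real.exp d ≤ Real.exp (5 / 4 * (k ^ 2 / n ^ 2)) := Real.exp_le_exp.2 hd1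
    generalize k ^ 2 / (n : ℝ) ^ 2 = y at *
    have h2 : 1 - 5 / 4 * y ≤ Real.exp (-(5 / 4 * y)) := by
      linarith [Real.add_one_le_exp (-(5 / 4 * y))]
    have h3 : Real.exp (5 / 4 * y) - 1 ≤ 5 / 4 * y * Real.exp (5 / 4 * y) := by
      have := mul_le_mul_of_nonneg_right h2 (Real.exp_pos (5 / 4 * y)).le
      rw [← Real.exp_add] at this
      simp at this
      linarith
    have h4 : Real.exp (5 / 4 * y) ≤ 8 := by
      calc Real.exp (5 / 4 * y) ≤ Real.exp 2 := Real.exp_le_exp.2 (by linarith)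
        _ = Real.exp 1 ^ 2 := by rw [← Real.exp_nat_mul]; norm_num
        _ ≤ 8 := by nlinarith [Real.exp_one_lt_d9, Real.exp_pos 1]
    have : 5 / 4 * y * Real.exp (5 / 4 * y) ≤ 5 / 4 * y * 8 := by gcongr
    linarith

end CurieWeiss

/-! Riemann sums of functions with integrable derivative. -/

lemma abs_mul_sub_integral_le {f f' : ℝ → ℝ} (hf : ∀ x, HasDerivAt f (f' x) x)
    (hf' : Continuous f') {a b c : ℝ} (hac : a ≤ c) (hcb : c ≤ b) :
    |(b - a) * f c - ∫ x in a..b, f x| ≤ (b - a) * ∫ x in a..b, |f' x| := by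
  have hab : a ≤ b := hac.trans hcb
  have hcont : Continuous f := continuous_iff_continuousAt.2 fun x => (hf x).continuousAt
  have h1 : (b - a) * f c - ∫ x in a..b, f x = ∫ x in a..b, (f c - f x) := by
    rw [intervalIntegral.integral_sub (by simp) (hcont.intervalIntegrable _ _)]
    simp
  rw [h1, ← Real.norm_eq_abs, mul_comm, ← abs_of_nonneg (sub_nonneg.2 hab)]
  refine intervalIntegral.norm_integral_le_of_norm_le_const fun x hx => ?_
  rw [Set.uIoc_of_le hab] at hx
  rw [← intervalIntegral.integral_eq_sub_of_hasDerivAt (fun y _ => hf y)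
    (hf'.intervalIntegrable x c)]
  refine (intervalIntegral.norm_integral_le_abs_integral_norm).trans ?_
  have := intervalIntegral.abs_integral_mono_interval (μ := volume) (f := fun y => |f' y|)
    (a := x) (b := c) (c := a) (d := b)
    (Set.uIoc_subset_uIoc_of_uIcc_subset_uIcc (by
      rw [Set.uIcc_of_le hab]
      exact Set.uIcc_subset_Icc ⟨hx.1.le, hx.2⟩ ⟨hac, hcb⟩))
    (Eventually.of_forall fun y => abs_nonneg _) (hf'.abs.intervalIntegrable _ _)
  rwa [abs_of_nonneg (a := ∫ y in a..b, |f' y|)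
    (intervalIntegral.integral_nonneg hab fun _ _ => abs_nonneg _)] at this

lemma abs_sum_mul_sub_integral_le {f f' : ℝ → ℝ} (hf : ∀ x, HasDerivAt f (f' x) x)
    (hf' : Continuous f') (hint : Integrable f') {a c : ℕ → ℝ} {δ : ℝ} (hδ : 0 ≤ δ)
    (ha : ∀ j, a (j + 1) - a j = δ) (hac : ∀ j, a j ≤ c j) (hca : ∀ j, c j ≤ a (j + 1)) (N : ℕ) :
    |∑ j ∈ Finset.range N, δ * f (c j) - ∫ x in a 0..a N, f x| ≤ δ * ∫ x, |f' x| := by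
  have hcont : Continuous f := continuous_iff_continuousAt.2 fun x => (hf x).continuousAt
  have hle : a 0 ≤ a N := monotone_nat_of_le_succ (fun j => (hac j).trans (hca j)) (Nat.zero_le N)
  rw [← intervalIntegral.sum_integral_adjacent_intervals
    (fun j _ => hcont.intervalIntegrable _ _), ← Finset.sum_sub_distrib]
  calc |∑ j ∈ Finset.range N, (δ * f (c j) - ∫ x in a j..a (j + 1), f x)|
      ≤ ∑ j ∈ Finset.range N, |δ * f (c j) - ∫ x in a j..a (j + 1), f x| :=
        Finset.abs_sum_le_sum_abs _ _
    _ ≤ ∑ j ∈ Finset.range N, δ * ∫ x in a j..a (j + 1), |f' x| := by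
        refine Finset.sum_le_sum fun j _ => ?_
        have := abs_mul_sub_integral_le hf hf' (hac j) (hca j)
        rwa [ha] at this
    _ = δ * ∫ x in a 0..a N, |f' x| := by
        rw [← Finset.mul_sum, intervalIntegral.sum_integral_adjacent_intervals
          (fun j _ => hf'.abs.intervalIntegrable _ _)]
    _ ≤ δ * ∫ x, |f' x| := by
        gcongr
        rw [intervalIntegral.integral_of_le hle]
        exact setIntegral_le_integral hint.abs (Eventually.of_forall fun _ => abs_nonneg _)

lemma abs_integral_sub_intervalIntegral_le {f : ℝ → ℝ} (hf : Integrable f)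
    (hf2 : Integrable fun x => x ^ 2 * |f x|) {T : ℝ} (hT : 0 < T) :
    |(∫ x, f x) - ∫ x in -T..T, f x| ≤ (∫ x, x ^ 2 * |f x|) / T ^ 2 := by
  rw [intervalIntegral.integral_of_le (by linarith),
    ← integral_add_compl (measurableSet_Ioc (a := -T) (b := T)) hf, add_sub_cancel_left,
    ← integral_div]
  refine (norm_integral_le_integral_norm f).trans ?_
  calc ∫ x in (Set.Ioc (-T) T)ᶜ, ‖f x‖ ≤ ∫ x in (Set.Ioc (-T) T)ᶜ, x ^ 2 * |f x| / T ^ 2 := by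
        refine setIntegral_mono_on hf.norm.integrableOn (hf2.div_const _).integrableOn
          measurableSet_Ioc.compl fun x hx => ?_
        have hTx : T ^ 2 ≤ x ^ 2 := by
          rw [Set.mem_compl_iff, Set.mem_Ioc, not_and_or, not_lt, not_le] at hx
          rcases hx with hx | hx <;> nlinarith
        rw [le_div_iff₀ (by positivity), mul_comm, Real.norm_eq_abs]
        gcongr
    _ ≤ ∫ x, x ^ 2 * |f x| / T ^ 2 :=
        setIntegral_le_integral (hf2.div_const _) (Eventually.of_forall fun x => by positivity)

namespace CurieWeiss

/-! Integrals against `exp (-x⁴/12)`. -/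

/-- The unnormalised quartic density. -/
noncomputable def quarticDensity (x : ℝ) : ℝ := Real.exp (-x ^ 4 / 12)

lemma quarticDensity_pos (x : ℝ) : 0 < quarticDensity x := Real.exp_pos _

lemma continuous_quarticDensity : Continuous quarticDensity := by
  unfold quarticDensity; fun_prop

lemma hasDerivAt_quarticDensity (x : ℝ) :
    HasDerivAt quarticDensity (-(x ^ 3 / 3) * quarticDensity x) x := by
  have h := (((hasDerivAt_id x).pow 4).neg.div_const 12).exp
  refine h.congr_deriv ?_
  simp [quarticDensity]
  ring

lemma integrable_pow_mul_quarticDensity (k : ℕ) :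
    Integrable fun x => x ^ k * quarticDensity x := by
  refine (integrable_inv_one_add_sq.const_mul
    (2 * ((k + 2).factorial * 12 ^ (k + 2) + Real.exp 1))).mono'
    (((continuous_id.pow k).mul continuous_quarticDensity).aestronglyMeasurable)
    (Eventually.of_forall fun x => ?_)
  rw [norm_mul, norm_pow, Real.norm_eq_abs, Real.norm_eq_abs,
    abs_of_pos (quarticDensity_pos x), ← div_eq_mul_inv, le_div_iff₀ (by positivity)]
  have hq1 : quarticDensity x ≤ 1 := 
    Real.exp_le_one_iff.2 (by
      have := (even_two_mul 2).pow_nonneg x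
      norm_num at this
      linarith)
  have hx : x ^ 2 = |x| ^ 2 := (sq_abs x).symm
  rcases le_total |x| 1 with h | h
  · have h1 : |x| ^ k ≤ 1 := pow_le_one₀ (abs_nonneg x) h
    have h2 : 1 + x ^ 2 ≤ 2 := by rw [hx]; nlinarith [abs_nonneg x]
    have h3 : |x| ^ k * quarticDensity x ≤ 1 := mul_le_one₀ h1 (quarticDensity_pos x).le hq1
    have h4 : (0 : ℝ) ≤ (k + 2).factorial * 12 ^ (k + 2) := by positivity
    have h5 : 1 ≤ Real.exp 1 := Real.one_le_exp (by norm_num)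
    calc |x| ^ k * quarticDensity x * (1 + x ^ 2) ≤ 1 * 2 := by gcongr
      _ ≤ _ := by linarith
  · have h1 : 1 + x ^ 2 ≤ 2 * |x| ^ 2 := by rw [hx]; nlinarith
    have h2 : |x| ^ (k + 2) * quarticDensity x ≤ (k + 2).factorial * 12 ^ (k + 2) := by
      have := Real.pow_div_factorial_le_exp (x ^ 4 / 12) (by positivity) (k + 2)
      rw [quarticDensity, neg_div, Real.exp_neg, ← div_eq_mul_inv, div_le_iff₀ (Real.exp_pos _)]
      calc |x| ^ (k + 2) ≤ (|x| ^ 4) ^ (k + 2) := by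
            gcongr
            exact le_self_pow₀ h (by norm_num)
        _ = (k + 2).factorial * 12 ^ (k + 2) * ((x ^ 4 / 12) ^ (k + 2) / (k + 2).factorial) := by
            rw [show x ^ 4 = |x| ^ 4 from (Even.pow_abs (by decide) x).symm, div_pow]
            field_simp
        _ ≤ _ := by gcongr
    calc |x| ^ k * quarticDensity x * (1 + x ^ 2) ≤ |x| ^ k * quarticDensity x * (2 * |x| ^ 2) := by
          have := quarticDensity_pos x
          gcongr
      _ = 2 * (|x| ^ (k + 2) * quarticDensity x) := by ring
      _ ≤ 2 * ((k + 2).factorial * 12 ^ (k + 2) + Real.exp 1) := by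
          linarith [Real.exp_pos 1]

lemma quarticConst_eq_integral : quarticConst = ∫ x, quarticDensity x := rfl

lemma quarticConst_eq : quarticConst
    = (3 : ℝ) ^ (1 / 4 : ℝ) * (2 : ℝ) ^ (-(1 / 2) : ℝ) * Real.Gamma (1 / 4) := by
  have h1 : quarticConst = ∫ x : ℝ, (fun y => Real.exp (-(1 / 12) * y ^ (4 : ℝ))) |x| := by
    rw [quarticConst]
    congr 1; ext x; dsimp only
    congr 1
    rw [show ((4 : ℝ)) = ((4 : ℕ) : ℝ) by norm_num, Real.rpow_natCast, Even.pow_abs (by decide)]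
    ring
  rw [h1, integral_comp_abs (f := fun y => Real.exp (-(1 / 12) * y ^ (4 : ℝ))),
    integral_exp_neg_mul_rpow (by norm_num) (by norm_num),
    Real.Gamma_add_one (by norm_num)]
  have h2 : (1 / 12 : ℝ) ^ (-1 / 4 : ℝ) = 3 ^ (1 / 4 : ℝ) * 2 ^ (1 / 2 : ℝ) := by
    rw [show (-1 / 4 : ℝ) = -(1 / 4) by norm_num, one_div (12 : ℝ),
      Real.rpow_neg (by norm_num), Real.inv_rpow (by norm_num), inv_inv,
      show (12 : ℝ) = 3 * 2 ^ (2 : ℝ) by norm_num,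
      Real.mul_rpow (by norm_num) (by positivity), ← Real.rpow_mul (by norm_num)]
    norm_num
  have h3 : (2 : ℝ) ^ (1 / 2 : ℝ) = 2 * 2 ^ (-(1 / 2) : ℝ) := by
    rw [show (1 / 2 : ℝ) = 1 + -(1 / 2) by norm_num, Real.rpow_add (by norm_num), Real.rpow_one]
    norm_num
  rw [h2, h3]
  ring

lemma quarticConst_pos : 0 < quarticConst := by
  rw [quarticConst_eq]
  have := Real.Gamma_pos_of_pos (show (0 : ℝ) < 1 / 4 by norm_num)
  positivity

lemma integral_quarticLaw (h : ℝ → ℝ) :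
    ∫ x, h x ∂quarticLaw = (∫ x, h x * quarticDensity x) / quarticConst := by
  rw [quarticLaw, integral_withDensity_eq_integral_toReal_smul
    (by fun_prop) (by simp), ← integral_div]
  congr 1; ext x
  rw [ENNReal.toReal_ofReal (div_nonneg (Real.exp_pos _).le quarticConst_pos.le), smul_eq_mul,
    quarticDensity]
  ring

end CurieWeiss

namespace CurieWeiss

/-- The rescaled magnetisation `(2 j - n) / n ^ (3/4)`, in terms of `b = n ^ (1/4)`. -/
noncomputable def gridPoint (n : ℕ) (b : ℝ) (j : ℕ) : ℝ := (2 * j - n) / b ^ 3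

lemma abs_sum_gridPoint_sub_integral_le {f f' : ℝ → ℝ} (hf : ∀ x, HasDerivAt f (f' x) x)
    (hf' : Continuous f') (hint : Integrable f') (n : ℕ) {b : ℝ} (hb : 0 < b) :
    |2 / b ^ 3 * ∑ j ∈ Finset.range (n + 1), f (gridPoint n b j)
        - ∫ x in -((n + 1) / b ^ 3)..((n + 1) / b ^ 3), f x| ≤ 2 / b ^ 3 * ∫ x, |f' x| := by
  have h := abs_sum_mul_sub_integral_le hf hf' hint (a := fun j => (2 * j - 1 - n) / b ^ 3)
    (c := gridPoint n b) (δ := 2 / b ^ 3) (by positivity) (fun j => by push_cast; ring)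
    (fun j => by unfold gridPoint; gcongr; linarith)
    (fun j => by unfold gridPoint; gcongr; push_cast; linarith) (n + 1)
  rw [← Finset.mul_sum] at h
  convert h using 5
  · push_cast; ring
  · push_cast; ring

lemma exists_sum_gridPoint_moments_le : ∃ K, 0 ≤ K ∧ ∀ (n : ℕ) (b : ℝ), 1 ≤ b →
    2 / b ^ 3 * ∑ j ∈ Finset.range (n + 1), (gridPoint n b j ^ 2 + gridPoint n b j ^ 6)
      * quarticDensity (gridPoint n b j) ≤ K := by
  set f : ℝ → ℝ := fun x => (x ^ 2 + x ^ 6) * quarticDensity x with hfdef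
  set f' : ℝ → ℝ := fun x =>
    (2 * x + 6 * x ^ 5 - (x ^ 2 + x ^ 6) * (x ^ 3 / 3)) * quarticDensity x with hf'def
  have hq := continuous_quarticDensity
  have hf : ∀ x, HasDerivAt f (f' x) x := fun x => by
    refine ((((hasDerivAt_id x).pow 2).add ((hasDerivAt_id x).pow 6)).mul
      (hasDerivAt_quarticDensity x)).congr_deriv ?_
    simp [hf'def]
    ring
  have hc' : Continuous f' := by fun_prop
  have hi : Integrable f := by
    refine ((integrable_pow_mul_quarticDensity 2).add
      (integrable_pow_mul_quarticDensity 6)).congr (Eventually.of_forall fun x => ?_)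
    simp [hfdef]
    ring
  have hi' : Integrable f' := by
    refine (((((integrable_pow_mul_quarticDensity 1).const_mul 2).add
      ((integrable_pow_mul_quarticDensity 5).const_mul (17 / 3))).sub
      ((integrable_pow_mul_quarticDensity 9).const_mul (1 / 3)))).congr
      (Eventually.of_forall fun x => ?_)
    simp [hf'def]
    ring
  have hf0 : ∀ x, 0 ≤ f x := fun x => mul_nonneg (by positivity) (quarticDensity_pos x).le
  have hI' : 0 ≤ ∫ x, |f' x| := integral_nonneg fun _ => abs_nonneg _
  refine ⟨(∫ x, f x) + 2 * ∫ x, |f' x|, add_nonneg (integral_nonneg hf0) (by positivity),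
    fun n b hb => ?_⟩
  have hb0 : 0 < b := by linarith
  have h1 := (abs_le.1 (abs_sum_gridPoint_sub_integral_le hf hc' hi' n hb0)).2
  have h2 : ∫ x in -((n + 1) / b ^ 3)..((n + 1) / b ^ 3), f x ≤ ∫ x, f x := by
    have : 0 ≤ ((n : ℝ) + 1) / b ^ 3 := by positivity
    rw [intervalIntegral.integral_of_le (by linarith)]
    exact setIntegral_le_integral hi (Eventually.of_forall hf0)
  have h3 : 2 / b ^ 3 * ∫ x, |f' x| ≤ 2 * ∫ x, |f' x| := by
    gcongr
    exact div_le_self (by norm_num) (one_le_pow₀ hb)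
  linarith

lemma exists_abs_sum_gridPoint_sub_integral_quarticDensity_le : ∃ K, 0 ≤ K ∧
    ∀ (n : ℕ) (b : ℝ), 1 ≤ b → b ^ 4 = n → ∀ h : ℝ → ℝ, ContDiff ℝ 1 h →
      ∀ A B : ℝ, (∀ x, |h x| ≤ A) → (∀ x, |deriv h x| ≤ B) →
        |2 / b ^ 3 * ∑ j ∈ Finset.range (n + 1), h (gridPoint n b j)
            * quarticDensity (gridPoint n b j) - ∫ x, h x * quarticDensity x|
          ≤ K / b ^ 2 * (A + B) := by
  have iabs : ∀ k, Integrable fun x => |x| ^ k * quarticDensity x := fun k => by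
    refine (integrable_pow_mul_quarticDensity k).norm.congr (Eventually.of_forall fun x => ?_)
    simp [abs_of_pos (quarticDensity_pos x)]
  set I : ℕ → ℝ := fun k => ∫ x, |x| ^ k * quarticDensity x with hI
  have hI0 : ∀ k, 0 ≤ I k := fun k => integral_nonneg fun x => by
    have := quarticDensity_pos x
    positivity
  refine ⟨2 * I 0 + I 2 + I 3, by linarith [hI0 0, hI0 2, hI0 3],
    fun n b hb hbn h hh A B hA hB => ?_⟩
  have hb0 : 0 < b := by linarith
  have hA0 : 0 ≤ A := (abs_nonneg _).trans (hA 0)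
  have hB0 : 0 ≤ B := (abs_nonneg _).trans (hB 0)
  have hq := continuous_quarticDensity
  have hhc := hh.continuous
  have hhd := hh.continuous_deriv le_rfl
  set f : ℝ → ℝ := fun x => h x * quarticDensity x with hfdef
  set f' : ℝ → ℝ := fun x =>
    deriv h x * quarticDensity x + h x * (-(x ^ 3 / 3) * quarticDensity x) with hf'def
  have hf : ∀ x, HasDerivAt f (f' x) x := fun x =>
    ((hh.differentiable one_ne_zero x).hasDerivAt).mul (hasDerivAt_quarticDensity x)
  have hc' : Continuous f' := by fun_prop
  have bf : ∀ x, |f x| ≤ A * (|x| ^ 0 * quarticDensity x) := fun x => by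
    have := quarticDensity_pos x
    rw [hfdef, abs_mul, abs_of_pos this, pow_zero, one_mul]
    gcongr
    exact hA x
  have bf2 : ∀ x, x ^ 2 * |f x| ≤ A * (|x| ^ 2 * quarticDensity x) := fun x => by
    rw [sq_abs]
    calc x ^ 2 * |f x| ≤ x ^ 2 * (A * (|x| ^ 0 * quarticDensity x)) := by gcongr; exact bf x
      _ = _ := by ring
  have bf' : ∀ x, |f' x|
      ≤ B * (|x| ^ 0 * quarticDensity x) + A / 3 * (|x| ^ 3 * quarticDensity x) := fun x => by
    have hx := quarticDensity_pos x
    refine (abs_add_le _ _).trans (add_le_add ?_ ?_)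
    · rw [abs_mul, abs_of_pos hx, pow_zero, one_mul]
      gcongr
      exact hB x
    · rw [abs_mul, abs_mul, abs_of_pos hx, abs_neg, abs_div, abs_pow, Nat.abs_ofNat]
      calc |h x| * (|x| ^ 3 / 3 * quarticDensity x) ≤ A * (|x| ^ 3 / 3 * quarticDensity x) := by
            gcongr; exact hA x
        _ = _ := by ring
  have i0 := (iabs 0).const_mul A
  have i2 := (iabs 2).const_mul A
  have i3 := ((iabs 0).const_mul B).add ((iabs 3).const_mul (A / 3))
  have hi : Integrable f :=
    i0.mono' (hhc.mul hq).aestronglyMeasurable (Eventually.of_forall bf)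
  have hi2 : Integrable fun x => x ^ 2 * |f x| :=
    i2.mono' (by fun_prop) (Eventually.of_forall fun x => by
      rw [Real.norm_eq_abs, abs_of_nonneg (by positivity)]
      exact bf2 x)
  have hi' : Integrable f' :=
    i3.mono' hc'.aestronglyMeasurable (Eventually.of_forall bf')
  have h1 := abs_sum_gridPoint_sub_integral_le hf hc' hi' n hb0
  have h2 := abs_integral_sub_intervalIntegral_le hi hi2
    (T := ((n : ℝ) + 1) / b ^ 3) (by positivity)
  have m2 : ∫ x, x ^ 2 * |f x| ≤ A * I 2 := by
    rw [hI, ← integral_const_mul]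
    exact integral_mono hi2 i2 bf2
  have m' : ∫ x, |f' x| ≤ B * I 0 + A / 3 * I 3 := by
    rw [hI, ← integral_const_mul, ← integral_const_mul, ← integral_add
      ((iabs 0).const_mul B) ((iabs 3).const_mul (A / 3))]
    exact integral_mono hi'.abs i3 bf'
  have hT : b ≤ ((n : ℝ) + 1) / b ^ 3 := by
    rw [le_div_iff₀ (by positivity), ← hbn]
    linarith [show b * b ^ 3 = b ^ 4 by ring]
  have e1 : 2 / b ^ 3 * ∫ x, |f' x| ≤ 2 / b ^ 2 * (B * I 0 + A / 3 * I 3) := by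
    refine mul_le_mul ?_ m' (integral_nonneg fun x => abs_nonneg (f' x)) (by positivity)
    gcongr 2 / ?_
    exact pow_le_pow_right₀ hb (by norm_num)
  have e2 : (∫ x, x ^ 2 * |f x|) / (((n : ℝ) + 1) / b ^ 3) ^ 2 ≤ A * I 2 / b ^ 2 := by
    gcongr
    exact mul_nonneg hA0 (hI0 2)
  have h3 := abs_sub_le (2 / b ^ 3 * ∑ j ∈ Finset.range (n + 1), f (gridPoint n b j))
    (∫ x in -((n + 1) / b ^ 3)..((n + 1) / b ^ 3), f x) (∫ x, f x)
  rw [abs_sub_comm (∫ x, f x)] at h2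
  have e3 : 2 / b ^ 2 * (B * I 0 + A / 3 * I 3) + A * I 2 / b ^ 2
      ≤ (2 * I 0 + I 2 + I 3) / b ^ 2 * (A + B) := by
    rw [div_mul_eq_mul_div 2, div_mul_eq_mul_div (2 * I 0 + I 2 + I 3), ← add_div]
    gcongr
    have a0 := mul_nonneg hA0 (hI0 0)
    have a2 := mul_nonneg hB0 (hI0 2)
    have a3 := mul_nonneg hA0 (hI0 3)
    have a4 := mul_nonneg hB0 (hI0 3)
    linarith
  change |2 / b ^ 3 * ∑ j ∈ Finset.range (n + 1), f (gridPoint n b j) - ∫ x, f x| ≤ _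
  linarith

/-- The weight of the magnetisation `2 j - n`, normalised to match the quartic density near `0`. -/
noncomputable def normalisedWeight (n : ℕ) (b : ℝ) (j : ℕ) : ℝ :=
  Real.exp (logRatio n j - logRatio n ((n + 1) / 2)) * quarticDensity (gridPoint n b j)

lemma choose_mul_exp_eq {n j : ℕ} {b : ℝ} (hb : 0 < b) (hbn : b ^ 4 = n) (hj : j ≤ n) :
    n.choose j * Real.exp ((2 * j - n : ℝ) ^ 2 / (2 * n))
      = Real.exp (logRatio n ((n + 1) / 2)) * normalisedWeight n b j := by
  have hc : (0 : ℝ) < n.choose j := by exact_mod_cast Nat.choose_pos hj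
  rw [normalisedWeight, quarticDensity]
  nth_rewrite 1 [← Real.exp_log hc]
  rw [← Real.exp_add, ← Real.exp_add, ← Real.exp_add]
  generalize logRatio n ((n + 1) / 2) = s
  rw [logRatio, gridPoint, ← hbn]
  congr 1
  field_simp
  ring

lemma exists_abs_sum_normalisedWeight_sub_integral_le : ∃ K, 0 < K ∧
    ∀ (n : ℕ) (b : ℝ), 1 ≤ n → 1 ≤ b → b ^ 4 = n → ∀ h : ℝ → ℝ, ContDiff ℝ 1 h →
      ∀ A B : ℝ, (∀ x, |h x| ≤ A) → (∀ x, |deriv h x| ≤ B) →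
        |2 / b ^ 3 * ∑ j ∈ Finset.range (n + 1), normalisedWeight n b j * h (gridPoint n b j)
            - ∫ x, h x * quarticDensity x| ≤ K / b ^ 2 * (A + B) := by
  obtain ⟨K₁, hK₁, h₁⟩ := exists_sum_gridPoint_moments_le
  obtain ⟨K₂, hK₂, h₂⟩ := exists_abs_sum_gridPoint_sub_integral_quarticDensity_le
  refine ⟨20 * K₁ + K₂ + 1, by positivity, fun n b hn hb hbn h hh A B hA hB => ?_⟩
  have hb0 : 0 < b := by linarith
  have hA0 : 0 ≤ A := (abs_nonneg _).trans (hA 0)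
  have hB0 : 0 ≤ B := (abs_nonneg _).trans (hB 0)
  have key : |2 / b ^ 3 * ∑ j ∈ Finset.range (n + 1), normalisedWeight n b j * h (gridPoint n b j)
      - 2 / b ^ 3 * ∑ j ∈ Finset.range (n + 1), h (gridPoint n b j)
        * quarticDensity (gridPoint n b j)| ≤ 20 * A / b ^ 2 * K₁ := by
    rw [← mul_sub, ← Finset.sum_sub_distrib, abs_mul, abs_of_pos (by positivity : 0 < 2 / b ^ 3)]
    refine le_trans ?_ (mul_le_mul_of_nonneg_left (h₁ n b hb) (by positivity))
    rw [mul_left_comm, Finset.mul_sum (Finset.range (n + 1)) _ (20 * A / b ^ 2)]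
    gcongr
    refine (Finset.abs_sum_le_sum_abs _ _).trans (Finset.sum_le_sum fun j hj => ?_)
    have hj' : j ≤ n := Nat.lt_succ_iff.1 (Finset.mem_range.1 hj)
    have hd := abs_exp_logRatio_sub_one_le hn hj'
    have hq := quarticDensity_pos (gridPoint n b j)
    have e : ((2 * j - n : ℝ) ^ 2 / n ^ 2 + (2 * j - n : ℝ) ^ 6 / n ^ 5)
        = (gridPoint n b j ^ 2 + gridPoint n b j ^ 6) / b ^ 2 := by
      rw [gridPoint, ← hbn]
      field_simp
    rw [e] at hd
    calc |normalisedWeight n b j * h (gridPoint n b j)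
          - h (gridPoint n b j) * quarticDensity (gridPoint n b j)|
        = |Real.exp (logRatio n j - logRatio n ((n + 1) / 2)) - 1| * |h (gridPoint n b j)|
          * quarticDensity (gridPoint n b j) := by
          rw [← abs_of_pos hq, ← abs_mul, ← abs_mul, abs_of_pos hq, normalisedWeight]
          congr 1
          ring
      _ ≤ 20 * ((gridPoint n b j ^ 2 + gridPoint n b j ^ 6) / b ^ 2) * A
          * quarticDensity (gridPoint n b j) := by
          gcongr
          exact hA _
      _ = _ := by ring
  have := h₂ n b hb hbn h hh A B hA hB
  refine (abs_sub_le _ _ _).trans ((add_le_add key this).trans ?_)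
  rw [div_mul_eq_mul_div, div_mul_eq_mul_div, div_mul_eq_mul_div, ← add_div]
  gcongr
  have := mul_nonneg hB0 hK₁
  linarith

end CurieWeiss

open CurieWeiss in
theorem theorem3p2 :
    CurieWeiss.quarticConst
        = (3 : ℝ) ^ (1 / 4 : ℝ) * (2 : ℝ) ^ (-(1 / 2) : ℝ) * Real.Gamma (1 / 4) ∧
    ∃ C : ℝ, 0 < C ∧
      ∃ r : ℕ → ℝ,
        (r =O[atTop] fun n : ℕ => 1 / (n : ℝ) ^ (3 / 4 : ℝ)) ∧
        ∀ n : ℕ, 1 ≤ n →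
          ∀ h : ℝ → ℝ, ContDiff ℝ 1 h →
            BddAbove (Set.range fun x => |h x|) →
            BddAbove (Set.range fun x => |deriv h x|) →
            |(∫ m, h (m / (n : ℝ) ^ (3 / 4 : ℝ)) ∂(CurieWeiss.magnetisationLaw n 1))
                - ∫ x, h x ∂CurieWeiss.quarticLaw|
              ≤ (C / Real.sqrt n + r n)
                  * (CurieWeiss.supNorm h + CurieWeiss.supNorm (deriv h)) := by
  refine ⟨quarticConst_eq, ?_⟩
  obtain ⟨K, hK, hmain⟩ := exists_abs_sum_normalisedWeight_sub_integral_le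
  have hZ := quarticConst_pos
  refine ⟨2 * K / quarticConst, by positivity, 0, isBigO_zero _ _, fun n hn h hh hA hB => ?_⟩
  have hn0 : (0 : ℝ) < n := by exact_mod_cast hn
  obtain ⟨b, hb⟩ : ∃ b : ℝ, b = (n : ℝ) ^ (1 / 4 : ℝ) := ⟨_, rfl⟩
  have hpow : ∀ k : ℕ, b ^ k = (n : ℝ) ^ (k / 4 : ℝ) := fun k => by
    rw [hb, ← Real.rpow_mul_natCast hn0.le]
    congr 1
    ring
  have hb1 : 1 ≤ b := hb ▸ Real.one_le_rpow (by exact_mod_cast hn) (by norm_num)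
  have hb0 : 0 < b := by linarith
  have hb4 : b ^ 4 = n := by rw [hpow]; norm_num
  have hb3 : (n : ℝ) ^ (3 / 4 : ℝ) = b ^ 3 := by rw [hpow]; norm_num
  have hb2 : Real.sqrt n = b ^ 2 := by rw [hpow, Real.sqrt_eq_rpow]; norm_num
  have hA' : ∀ x, |h x| ≤ supNorm h := fun x => le_ciSup hA x
  have hB' : ∀ x, |deriv h x| ≤ supNorm (deriv h) := fun x => le_ciSup hB x
  set A := supNorm h
  set B := supNorm (deriv h)
  have hA0 : 0 ≤ A := (abs_nonneg _).trans (hA' 0)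
  have hB0 : 0 ≤ B := (abs_nonneg _).trans (hB' 0)
  set S : (ℝ → ℝ) → ℝ := fun g =>
    2 / b ^ 3 * ∑ j ∈ Finset.range (n + 1), normalisedWeight n b j * g (gridPoint n b j) with hS
  have hS1 : 0 < S fun _ => 1 := by
    refine mul_pos (by positivity) (Finset.sum_pos (fun j _ => ?_) (by simp))
    exact mul_pos (mul_pos (Real.exp_pos _) (quarticDensity_pos _)) one_pos
  have hlaw : ∫ m, h (m / (n : ℝ) ^ (3 / 4 : ℝ)) ∂(magnetisationLaw n 1) = S h / S fun _ => 1 := by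
    have hhm := hh.continuous.measurable
    rw [integral_magnetisationLaw_one n (fun m => h (m / (n : ℝ) ^ (3 / 4 : ℝ))) (by fun_prop),
      hb3, hS]
    have e : ∀ j ∈ Finset.range (n + 1),
        n.choose j * Real.exp ((2 * j - n : ℝ) ^ 2 / (2 * n))
          = Real.exp (logRatio n ((n + 1) / 2)) * normalisedWeight n b j := fun j hj =>
      choose_mul_exp_eq hb0 hb4 (Nat.lt_succ_iff.1 (Finset.mem_range.1 hj))
    rw [Finset.sum_congr rfl e, Finset.sum_congr rfl fun j hj => by rw [e j hj, mul_assoc],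
      ← Finset.mul_sum, ← Finset.mul_sum, mul_div_mul_left _ _ (Real.exp_pos _).ne',
      mul_div_mul_left _ _ (by positivity)]
    simp [gridPoint]
  have h1 := hmain n b hn hb1 hb4 h hh A B hA' hB'
  have h2 := hmain n b hn hb1 hb4 (fun _ => 1) contDiff_const 1 0 (by simp) (by simp)
  simp only [one_mul, ← quarticConst_eq_integral, add_zero, mul_one] at h2
  have hSh : |S h| ≤ A * S fun _ => 1 := by
    rw [hS]
    dsimp only
    rw [abs_mul, abs_of_pos (by positivity : 0 < 2 / b ^ 3), mul_left_comm, Finset.mul_sum _ _ A]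
    gcongr
    refine (Finset.abs_sum_le_sum_abs _ _).trans (Finset.sum_le_sum fun j _ => ?_)
    have hw : 0 < normalisedWeight n b j := mul_pos (Real.exp_pos _) (quarticDensity_pos _)
    rw [abs_mul, abs_of_pos hw, mul_one, mul_comm]
    gcongr
    exact hA' _
  have h2' : |(S fun _ => 1) - quarticConst| ≤ K / b ^ 2 := by simpa [hS] using h2
  change |S h - _| ≤ _ at h1
  rw [hlaw, integral_quarticLaw, hb2, Pi.zero_apply, add_zero]
  generalize (S fun _ => 1) = s at *
  generalize (∫ x, h x * quarticDensity x) = t at *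
  generalize S h = u at *
  have e1 : u / s - t / quarticConst
      = u / s * ((quarticConst - s) / quarticConst) + (u - t) / quarticConst := by
    field_simp
    ring
  have e2 : |u / s| ≤ A := by rw [abs_div, abs_of_pos hS1, div_le_iff₀ hS1]; exact hSh
  rw [e1]
  calc |u / s * ((quarticConst - s) / quarticConst) + (u - t) / quarticConst|
      ≤ |u / s| * (|s - quarticConst| / quarticConst) + |u - t| / quarticConst := by
        refine (abs_add_le _ _).trans_eq ?_
        rw [abs_mul, abs_div _ quarticConst, abs_div _ quarticConst, abs_of_pos hZ,
          abs_sub_comm quarticConst]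
    _ ≤ A * (K / b ^ 2 / quarticConst) + K / b ^ 2 * (A + B) / quarticConst := by gcongr
    _ = (2 * A + B) * (K / b ^ 2 / quarticConst) := by ring
    _ ≤ (2 * (A + B)) * (K / b ^ 2 / quarticConst) := by gcongr; linarith
    _ = 2 * K / quarticConst / b ^ 2 * (A + B) := by ring
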